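/- Let $\widehat{\mathbb C}=\mathbb C\cup\{\infty\}$ carry the spherical distance $\chi$, i.e. half of the Euclidean distance in $\mathbb R^3$ of the images under stereographic projection onto the unit sphere. For a Riemann surface $\Sigma$ (connected, Hausdorff and second countable), let $\mathcal M(\Sigma)$ be the set of holomorphic maps $\Sigma\to\widehat{\mathbb C}$, with the topology of uniform convergence on compact subsets with respect to $\chi$. A property $P$ of $\widehat{\mathbb C}$-valued holomorphic maps is given by the subsets $\mathcal P(\Sigma)\subset\mathcal M(\Sigma)$ of the maps that satisfy it on $\Sigma$. It is called a closed property if the following hold: (P1) for all Riemann surfaces $\Sigma,\Sigma'$ and every holomorphic map $\phi:\Sigma\to\Sigma'$ without ramification points, $f\in\mathcal P(\Sigma')$ implies $f\circ\phi\in\mathcal P(\Sigma)$; (P2) if $f\in\mathcal M(\Sigma)$ and $f|_\Omega\in\mathcal P(\Omega)$ for every relatively compact domain $\Omega$ of $\Sigma$, then $f\in\mathcal P(\Sigma)$; (P3) for every Riemann surface $\Sigma$, $\mathcal P(\Sigma)$ is a closed subset of $\mathcal M(\Sigma)$. It is called a compact property if, in addition, (P4) for every Riemann surface $\Sigma$,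 $\mathcal P(\Sigma)$ is normal, i.e. every sequence in $\mathcal P(\Sigma)$ has a subsequence that converges in $\mathcal M(\Sigma)$ (uniformly on compact subsets with respect to $\chi$). Theorem. For a subset $X\subset\widehat{\mathbb C}$, let $P_X$ be the property of a holomorphic map $f:\Sigma\to\widehat{\mathbb C}$ that $f(\Sigma)\subset\widehat{\mathbb C}\setminus X$ or $f$ is constant on $\Sigma$. Then $P_X$ is a closed property for every $X \subset \widehat{\mathbb C}$, and it is a compact property if $X$ contains $3$ or more elements (Carathéodory–Montel). Moreover, every holomorphic map $f:\mathbb C\to\widehat{\mathbb C}$ that omits at least $3$ values of $\widehat{\mathbb C}$ is constant (Picard's little theorem). -/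

import Mathlib

open Set Filter Topology
open scoped Manifold ContDiff

/-! ### The extended complex plane -/

/-- The extended complex plane `ℂ ∪ {∞}`, with the topology of the one-point compactification. -/
abbrev CHat : Type := OnePoint ℂ

namespace CHat

/-- The stereographic projection `π_N : ℂ ∪ {∞} → S² ⊂ ℝ³`, sending `∞` to `(0, 0, 1)`. -/
noncomputable def stereo (x : CHat) : EuclideanSpace ℝ (Fin 3) :=
  x.elim !₂[0, 0, 1] fun z =>
    !₂[2 * z.re / (‖z‖ ^ 2 + 1), 2 * z.im / (‖z‖ ^ 2 + 1), (‖z‖ ^ 2 - 1) / (‖z‖ ^ 2 + 1)]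

theorem stereo_infty : stereo OnePoint.infty = !₂[0, 0, 1] := rfl

theorem stereo_coe (z : ℂ) : stereo (z : CHat) =
    !₂[2 * z.re / (‖z‖ ^ 2 + 1), 2 * z.im / (‖z‖ ^ 2 + 1), (‖z‖ ^ 2 - 1) / (‖z‖ ^ 2 + 1)] := rfl

theorem dist_stereo_coe_infty (z : ℂ) :
    dist (stereo (z : CHat)) (stereo OnePoint.infty) = 2 * (1 / √(1 + ‖z‖ ^ 2)) := by
  have h : 0 < 1 + ‖z‖ ^ 2 := by positivity
  have hn : ‖z‖ ^ 2 = z.re ^ 2 + z.im ^ 2 := by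
    rw [← Complex.normSq_eq_norm_sq, Complex.normSq_apply]; ring
  rw [stereo_coe, stereo_infty, EuclideanSpace.dist_eq, Fin.sum_univ_three]
  rw [Real.sqrt_eq_iff_mul_self_eq (by positivity) (by positivity)]
  simp only [Real.dist_eq, sq_abs]
  have e : 2 * (1 / √(1 + ‖z‖ ^ 2)) * (2 * (1 / √(1 + ‖z‖ ^ 2))) = 4 / (1 + ‖z‖ ^ 2) := by
    rw [show 2 * (1 / √(1 + ‖z‖ ^ 2)) * (2 * (1 / √(1 + ‖z‖ ^ 2))) =
      4 / (√(1 + ‖z‖ ^ 2) * √(1 + ‖z‖ ^ 2)) by field_simp; norm_num]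
    rw [Real.mul_self_sqrt h.le]
  rw [e]
  simp
  rw [hn] at h ⊢
  have h' : z.re ^ 2 + z.im ^ 2 + 1 ≠ 0 := by positivity
  field_simp
  ring

theorem dist_stereo_coe_coe (z w : ℂ) :
    dist (stereo (z : CHat)) (stereo (w : CHat)) =
      2 * (‖z - w‖ / (√(1 + ‖z‖ ^ 2) * √(1 + ‖w‖ ^ 2))) := by
  have hn : ∀ z : ℂ, ‖z‖ ^ 2 = z.re ^ 2 + z.im ^ 2 := fun z => by
    rw [← Complex.normSq_eq_norm_sq, Complex.normSq_apply]; ring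
  rw [stereo_coe, stereo_coe, EuclideanSpace.dist_eq, Fin.sum_univ_three]
  rw [Real.sqrt_eq_iff_mul_self_eq (by positivity) (by positivity)]
  simp only [Real.dist_eq, sq_abs]
  have e : 2 * (‖z - w‖ / (√(1 + ‖z‖ ^ 2) * √(1 + ‖w‖ ^ 2))) *
      (2 * (‖z - w‖ / (√(1 + ‖z‖ ^ 2) * √(1 + ‖w‖ ^ 2)))) =
      4 * ‖z - w‖ ^ 2 / ((1 + ‖z‖ ^ 2) * (1 + ‖w‖ ^ 2)) := by
    have h1 := Real.mul_self_sqrt (show (0 : ℝ) ≤ 1 + ‖z‖ ^ 2 by positivity)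
    have h2 := Real.mul_self_sqrt (show (0 : ℝ) ≤ 1 + ‖w‖ ^ 2 by positivity)
    have h3 : √(1 + ‖z‖ ^ 2) ≠ 0 := by positivity
    have h4 : √(1 + ‖w‖ ^ 2) ≠ 0 := by positivity
    conv_rhs => rw [← h1, ← h2]
    field_simp
    ring
  rw [e, hn z, hn w, hn (z - w)]
  have h1 : z.re ^ 2 + z.im ^ 2 + 1 ≠ 0 := by positivity
  have h2 : w.re ^ 2 + w.im ^ 2 + 1 ≠ 0 := by positivity
  have h3 : 1 + (z.re ^ 2 + z.im ^ 2) ≠ 0 := by positivity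
  have h4 : 1 + (w.re ^ 2 + w.im ^ 2) ≠ 0 := by positivity
  simp
  field_simp
  ring

theorem stereo_injective : Function.Injective stereo := by
  intro x y h
  have h0 : dist (stereo x) (stereo y) = 0 := by rw [h, dist_self]
  induction x using OnePoint.rec with
  | infty =>
    induction y using OnePoint.rec with
    | infty => rfl
    | coe w =>
      rw [dist_comm, dist_stereo_coe_infty] at h0
      have : (0 : ℝ) < 2 * (1 / √(1 + ‖w‖ ^ 2)) := by positivity
      exact absurd h0 this.ne'
  | coe z =>
    induction y using OnePoint.rec with
    | infty =>
      rw [dist_stereo_coe_infty] at h0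
      have : (0 : ℝ) < 2 * (1 / √(1 + ‖z‖ ^ 2)) := by positivity
      exact absurd h0 this.ne'
    | coe w =>
      rw [dist_stereo_coe_coe] at h0
      have h3 : √(1 + ‖z‖ ^ 2) ≠ 0 := by positivity
      have h4 : √(1 + ‖w‖ ^ 2) ≠ 0 := by positivity
      have : ‖z - w‖ = 0 := by
        simpa [h3, h4] using h0
      rw [norm_eq_zero, sub_eq_zero] at this
      rw [this]

theorem continuous_stereo : Continuous stereo := by
  rw [OnePoint.continuous_iff]
  constructor
  · rw [tendsto_iff_dist_tendsto_zero]
    simp only [dist_stereo_coe_infty]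
    rw [Filter.coclosedCompact_eq_cocompact]
    have h1 : Tendsto (fun z : ℂ => √(1 + ‖z‖ ^ 2)) (cocompact ℂ) atTop :=
      Real.tendsto_sqrt_atTop.comp (tendsto_atTop_add_const_left _ _
        ((tendsto_pow_atTop two_ne_zero).comp tendsto_norm_cocompact_atTop))
    simpa using (h1.inv_tendsto_atTop.const_mul 2)
  · have h : ∀ z : ℂ, ‖z‖ ^ 2 + 1 ≠ 0 := fun z => by positivity
    change Continuous fun z : ℂ => (!₂[2 * z.re / (‖z‖ ^ 2 + 1), 2 * z.im / (‖z‖ ^ 2 + 1),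
      (‖z‖ ^ 2 - 1) / (‖z‖ ^ 2 + 1)] : EuclideanSpace ℝ (Fin 3))
    refine (PiLp.continuous_toLp 2 _).comp (continuous_pi fun i => ?_)
    fin_cases i
    · exact (continuous_const.mul Complex.continuous_re).div (by fun_prop) h
    · exact (continuous_const.mul Complex.continuous_im).div (by fun_prop) h
    · exact Continuous.div (by fun_prop) (by fun_prop) h

/-- The stereographic projection followed by the scaling with factor `1 / 2`. -/
noncomputable def halfStereo (x : CHat) : EuclideanSpace ℝ (Fin 3) := (1 / 2 : ℝ) • stereo x

theorem isEmbedding_halfStereo : IsEmbedding halfStereo := by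
  have hc : Continuous halfStereo := continuous_stereo.const_smul (1 / 2 : ℝ)
  refine (hc.isClosedEmbedding fun x y h => stereo_injective ?_).isEmbedding
  exact smul_right_injective _ (by norm_num : (1 / 2 : ℝ) ≠ 0) h

/-- The spherical distance `χ`: half of the Euclidean distance of the stereographic projections.
It induces the topology that `ℂ ∪ {∞}` already has. -/
noncomputable instance : MetricSpace CHat := isEmbedding_halfStereo.comapMetricSpace halfStereo

theorem dist_eq (x y : CHat) : dist x y = dist (stereo x) (stereo y) / 2 := by
  change dist (halfStereo x) (halfStereo y) = _
  rw [halfStereo, halfStereo, dist_smul₀]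
  norm_num
  ring

theorem dist_coe_coe (z w : ℂ) :
    dist (z : CHat) (w : CHat) = ‖z - w‖ / (√(1 + ‖z‖ ^ 2) * √(1 + ‖w‖ ^ 2)) := by
  rw [dist_eq, dist_stereo_coe_coe]; ring

theorem dist_coe_infty (z : ℂ) :
    dist (z : CHat) OnePoint.infty = 1 / √(1 + ‖z‖ ^ 2) := by
  rw [dist_eq, dist_stereo_coe_infty]; ring

/-! ### The complex structure of the extended complex plane: the charts `z` and `1 / z` -/

/-- The map `z ↦ 1 / z` of `ℂ ∪ {∞}`, exchanging `0` and `∞`. -/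
noncomputable def inversion (x : CHat) : CHat :=
  x.elim ((0 : ℂ) : CHat) fun z => if z = 0 then OnePoint.infty else ((z⁻¹ : ℂ) : CHat)

theorem inversion_infty : inversion OnePoint.infty = ((0 : ℂ) : CHat) := rfl

theorem inversion_zero : inversion ((0 : ℂ) : CHat) = OnePoint.infty := if_pos rfl

theorem inversion_coe {z : ℂ} (hz : z ≠ 0) : inversion (z : CHat) = ((z⁻¹ : ℂ) : CHat) :=
  if_neg hz

theorem inversion_inversion (x : CHat) : inversion (inversion x) = x := by
  induction x using OnePoint.rec with
  | infty => rw [inversion_infty, inversion_zero]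
  | coe z =>
    by_cases hz : z = 0
    · rw [hz, inversion_zero, inversion_infty]
    · rw [inversion_coe hz, inversion_coe (inv_ne_zero hz), inv_inv]

theorem stereo_inversion (x : CHat) :
    stereo (inversion x) = !₂[stereo x 0, - stereo x 1, - stereo x 2] := by
  induction x using OnePoint.rec with
  | infty => rw [inversion_infty, stereo_infty, stereo_coe]; ext i; fin_cases i <;> simp
  | coe z =>
    by_cases hz : z = 0
    · rw [hz, inversion_zero, stereo_infty, stereo_coe]; ext i; fin_cases i <;> simp
    · rw [inversion_coe hz, stereo_coe, stereo_coe]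
      have h0 : ‖z‖ ^ 2 ≠ 0 := by simpa using hz
      have h1 : ‖z‖ ^ 2 + 1 ≠ 0 := by positivity
      ext i
      fin_cases i <;>
        simp [Complex.inv_re, Complex.inv_im, Complex.normSq_eq_norm_sq] <;>
        field_simp <;> ring

theorem continuous_inversion : Continuous inversion := by
  have hemb : IsEmbedding stereo :=
    (continuous_stereo.isClosedEmbedding stereo_injective).isEmbedding
  rw [hemb.continuous_iff]
  have : stereo ∘ inversion = fun x => !₂[stereo x 0, - stereo x 1, - stereo x 2] :=
    funext stereo_inversion
  rw [this]
  have hi : ∀ i, Continuous fun x : CHat => stereo x i := fun i =>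
    (PiLp.continuous_apply 2 _ i).comp continuous_stereo
  refine (PiLp.continuous_toLp 2 _).comp (continuous_pi fun i => ?_)
  fin_cases i
  · exact hi 0
  · exact (hi 1).neg
  · exact (hi 2).neg

/-- `z ↦ 1 / z` as a homeomorphism of `ℂ ∪ {∞}`. -/
noncomputable def inversionHomeomorph : CHat ≃ₜ CHat where
  toFun := inversion
  invFun := inversion
  left_inv := inversion_inversion
  right_inv := inversion_inversion
  continuous_toFun := continuous_inversion
  continuous_invFun := continuous_inversion

/-- The chart `z` on `ℂ`, with inverse the inclusion `ℂ → ℂ ∪ {∞}`. -/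
noncomputable def chartZ : OpenPartialHomeomorph CHat ℂ :=
  ((OnePoint.isOpenEmbedding_coe (X := ℂ)).toOpenPartialHomeomorph _).symm

/-- The chart `1 / z` on `(ℂ \ {0}) ∪ {∞}`. -/
noncomputable def chartInv : OpenPartialHomeomorph CHat ℂ :=
  inversionHomeomorph.transOpenPartialHomeomorph chartZ

theorem chartZ_source : chartZ.source = {OnePoint.infty}ᶜ := by
  simp [chartZ, OnePoint.compl_infty]

theorem chartZ_target : chartZ.target = univ := by
  simp [chartZ]

theorem chartZ_coe (z : ℂ) : chartZ (z : CHat) = z :=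
  (OnePoint.isOpenEmbedding_coe (X := ℂ)).toOpenPartialHomeomorph_left_inv _

theorem chartZ_symm (z : ℂ) : chartZ.symm z = (z : CHat) := rfl

theorem chartInv_source : chartInv.source = {((0 : ℂ) : CHat)}ᶜ := by
  ext x
  change inversion x ∈ chartZ.source ↔ _
  rw [chartZ_source, mem_compl_singleton_iff, mem_compl_singleton_iff, not_iff_not]
  exact ⟨fun h => by rw [← inversion_inversion x, h, inversion_infty],
    fun h => by rw [h, inversion_zero]⟩

theorem chartInv_target : chartInv.target = univ := chartZ_target

theorem chartInv_apply (x : CHat) : chartInv x = chartZ (inversion x) := rfl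

theorem chartInv_symm (z : ℂ) : chartInv.symm z = inversion (z : CHat) := rfl

open Classical in
noncomputable instance : ChartedSpace ℂ CHat where
  atlas := {chartZ, chartInv}
  chartAt x := if x = OnePoint.infty then chartInv else chartZ
  mem_chart_source x := by
    split_ifs with h
    · rw [chartInv_source, h]; exact OnePoint.infty_ne_coe _
    · rw [chartZ_source]; exact h
  chart_mem_atlas x := by
    split_ifs <;> simp

instance : IsManifold 𝓘(ℂ) ω CHat := by
  refine isManifold_of_contDiffOn _ _ _ fun e e' he he' => ?_
  have hinv : ∀ e e' : OpenPartialHomeomorph CHat ℂ,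
      (e = chartZ ∧ e' = chartInv ∨ e = chartInv ∧ e' = chartZ) →
      ContDiffOn ℂ ω (e.symm ≫ₕ e') (e.symm ≫ₕ e').source := by
    rintro e e' (⟨rfl, rfl⟩ | ⟨rfl, rfl⟩)
    · have hs : (chartZ.symm ≫ₕ chartInv).source ⊆ {0}ᶜ := by
        intro z hz
        have h2 : (z : CHat) ∈ chartInv.source := hz.2
        rw [chartInv_source] at h2
        exact fun h => h2 (by rw [mem_singleton_iff.1 h]; rfl)
      refine ContDiffOn.congr (f := fun z => z⁻¹)
        (fun z hz => (contDiffAt_inv ℂ (hs hz)).contDiffWithinAt) fun z hz => ?_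
      change chartZ (inversion (z : CHat)) = _
      rw [inversion_coe (hs hz), chartZ_coe]
    · have hs : (chartInv.symm ≫ₕ chartZ).source ⊆ {0}ᶜ := by
        intro z hz
        have h2 : inversion (z : CHat) ∈ chartZ.source := hz.2
        rw [chartZ_source] at h2
        exact fun h => h2 (by rw [mem_singleton_iff.1 h, inversion_zero]; rfl)
      refine ContDiffOn.congr (f := fun z => z⁻¹)
        (fun z hz => (contDiffAt_inv ℂ (hs hz)).contDiffWithinAt) fun z hz => ?_
      change chartZ (inversion (z : CHat)) = _
      rw [inversion_coe (hs hz), chartZ_coe]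
  have hid : ∀ e : OpenPartialHomeomorph CHat ℂ,
      ContDiffOn ℂ ω (e.symm ≫ₕ e) (e.symm ≫ₕ e).source := fun e =>
    contDiffOn_id.congr fun z hz => e.right_inv hz.1
  have key : ContDiffOn ℂ ω (e.symm ≫ₕ e') (e.symm ≫ₕ e').source := by
    rcases he with rfl | he <;> rcases he' with rfl | he'
    · exact hid _
    · exact hinv _ _ (Or.inl ⟨rfl, he'⟩)
    · exact hinv _ _ (Or.inr ⟨he, rfl⟩)
    · rw [mem_singleton_iff.1 he, mem_singleton_iff.1 he']; exact hid _
  simpa using key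

end CHat

/-! ### Riemann surfaces and holomorphic maps -/

universe u

/-- A Riemann surface: a connected Hausdorff second countable complex manifold of dimension one
(second countability follows from the other conditions by Radó's theorem). -/
structure RiemannSurface : Type (u + 1) where
  carrier : Type u
  [top : TopologicalSpace carrier]
  [charted : ChartedSpace ℂ carrier]
  [manifold : IsManifold 𝓘(ℂ) ω carrier]
  [t2 : T2Space carrier]
  [secondCountable : SecondCountableTopology carrier]
  [connected : ConnectedSpace carrier]

namespace RiemannSurface

instance : CoeSort RiemannSurface.{u} (Type u) := ⟨carrier⟩

attribute [instance] top charted manifold t2 secondCountable connected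

/-- A domain (a nonempty connected open subset) of a Riemann surface, as a Riemann surface. -/
noncomputable def domain (S : RiemannSurface.{u}) (Ω : TopologicalSpace.Opens S)
    (hΩ : IsConnected (Ω : Set S)) : RiemannSurface.{u} :=
  haveI : ConnectedSpace Ω := isConnected_iff_connectedSpace.1 hΩ
  { carrier := Ω }

end RiemannSurface

/-- The space `𝓜(Σ)` of the holomorphic maps from the Riemann surface `Σ` to `ℂ ∪ {∞}`. -/
def HolMap (S : RiemannSurface.{u}) : Type u :=
  {f : S → CHat // MDifferentiable 𝓘(ℂ) 𝓘(ℂ) f}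

namespace HolMap

instance (S : RiemannSurface.{u}) : CoeFun (HolMap S) fun _ => S → CHat := ⟨Subtype.val⟩

/-- A holomorphic map as a continuous map. -/
def toContinuousMap {S : RiemannSurface.{u}} (f : HolMap S) : C(S, CHat) :=
  ⟨f, f.2.continuous⟩

/-- The topology of `𝓜(Σ)`: uniform convergence on compact subsets with respect to `χ`, which is the
topology that Mathlib puts on `C(Σ, ℂ ∪ {∞})`; see `HolMap.tendsto_iff`. -/
noncomputable instance (S : RiemannSurface.{u}) : TopologicalSpace (HolMap S) :=
  TopologicalSpace.induced toContinuousMap inferInstance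

theorem tendsto_iff {S : RiemannSurface.{u}} {ι : Type*} {l : Filter ι} {F : ι → HolMap S}
    {f : HolMap S} : Tendsto F l (𝓝 f) ↔ ∀ K : Set S, IsCompact K → ∀ ε > 0,
      ∀ᶠ i in l, ∀ z ∈ K, dist (f z) (F i z) < ε := by
  rw [nhds_induced, tendsto_comap_iff, ContinuousMap.tendsto_iff_forall_isCompact_tendstoUniformlyOn]
  simp only [Metric.tendstoUniformlyOn_iff]
  rfl

/-- The composition `f ∘ φ` of `f ∈ 𝓜(Σ')` with a holomorphic map `φ : Σ → Σ'`. -/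
def comp {S S' : RiemannSurface.{u}} (f : HolMap S') (φ : S → S')
    (hφ : MDifferentiable 𝓘(ℂ) 𝓘(ℂ) φ) : HolMap S :=
  ⟨fun z => f (φ z), f.2.comp hφ⟩

/-- The restriction `f|_Ω` of `f ∈ 𝓜(Σ)` to a domain `Ω` of `Σ`. -/
noncomputable def restrict {S : RiemannSurface.{u}} (f : HolMap S) (Ω : TopologicalSpace.Opens S)
    (hΩ : IsConnected (Ω : Set S)) : HolMap (S.domain Ω hΩ) :=
  ⟨fun z => f (Subtype.val z),
    f.2.comp ((contMDiff_subtype_val (I := 𝓘(ℂ)) (n := 1)).mdifferentiable one_ne_zero)⟩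

end HolMap

/-! ### Closed and compact properties -/

/-- A property `P` for holomorphic maps to `ℂ ∪ {∞}`, given by the sets `𝓟(Σ) ⊆ 𝓜(Σ)` of the maps
that have it. -/
abbrev HolProperty : Type (u + 1) := ∀ S : RiemannSurface.{u}, Set (HolMap S)

/-- A family `𝓕 ⊆ 𝓜(Σ)` is normal if each sequence in `𝓕` has a subsequence that converges uniformly
on the compact subsets of `Σ` with respect to `χ`, that is, converges in `𝓜(Σ)`. -/
def IsNormalFamily {S : RiemannSurface.{u}} (𝓕 : Set (HolMap S)) : Prop :=
  ∀ F : ℕ → HolMap S, (∀ n, F n ∈ 𝓕) →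
    ∃ k : ℕ → ℕ, StrictMono k ∧ ∃ g : HolMap S, Tendsto (fun n => F (k n)) atTop (𝓝 g)

/-- The axioms (P1), (P2), (P3) of a closed property. -/
structure IsClosedProperty (P : HolProperty.{u}) : Prop where
  /-- Composition with holomorphic maps `φ` without ramification points, that is, whose
  differential vanishes nowhere. -/
  comp_mem : ∀ (S S' : RiemannSurface.{u}) (φ : S → S') (hφ : MDifferentiable 𝓘(ℂ) 𝓘(ℂ) φ),
    (∀ p, mfderiv 𝓘(ℂ) 𝓘(ℂ) φ p ≠ 0) → ∀ f ∈ P S', f.comp φ hφ ∈ P S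
  /-- The property holds on `Σ` if it holds on all relatively compact domains of `Σ`. -/
  mem_of_restrict : ∀ (S : RiemannSurface.{u}) (f : HolMap S),
    (∀ (Ω : TopologicalSpace.Opens S) (hΩ : IsConnected (Ω : Set S)),
      IsCompact (closure (Ω : Set S)) → f.restrict Ω hΩ ∈ P (S.domain Ω hΩ)) → f ∈ P S
  /-- `𝓟(Σ)` is closed in `𝓜(Σ)`. -/
  isClosed : ∀ S : RiemannSurface.{u}, IsClosed (P S)

/-- A compact property is a closed property with the axiom (P4): each `𝓟(Σ)` is normal. -/
structure IsCompactProperty (P : HolProperty.{u}) : Prop extends IsClosedProperty P where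
  isNormalFamily : ∀ S : RiemannSurface.{u}, IsNormalFamily (P S)

/-- The property `P_X`: `f` omits all elements of `X`, or `f` is constant. -/
def omitProperty (X : Set CHat) : HolProperty.{u} := fun _ =>
  {f | range f ⊆ Xᶜ ∨ ∃ c, ∀ z, f z = c}

/-!
The theorem rests on one estimate (`norm_deriv_le_of_omits_zero_one`, Landau's theorem in spherical
form): if a holomorphic function `f` omits `0` and `1` on a disc of radius `R`, then its spherical
derivative `|f'| / (1 + |f|²)` at the centre is at most an absolute constant times `1 / R`.
To prove it, write `f = exp (2 π i F)` and then `2 F - 1 = cosh (2 g)` with holomorphic `F` and `g`.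
As `F` omits the integers, `g` omits a set of points that meets every disc of radius `2`, so
Bloch's theorem (`exists_ball_subset_image_ball`) bounds `g'` at the centre by a multiple of `1 / R`.
Since the logarithm `2 π i F` can be chosen with imaginary part in `[-π, π]` at the centre, the chain
rule turns this into the bound for `f`, the factor `|F|` being of size `|log |f|| + π` only.

Three arbitrary omitted values are moved to `∞, 0, 1` by a Möbius transformation. Letting `R → ∞` gives
Picard's little theorem. On a Riemann surface, the estimate says that the maps with `P_X` have a
common local Lipschitz constant with respect to the spherical distance (after the Möbius
transformation), hence are equicontinuous. By the Arzelà–Ascoli theorem each sequence of them has a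
locally uniformly convergent subsequence, whose limit is holomorphic by Weierstrass's theorem. This is
(P4).

Of the axioms of a closed property, (P1) is immediate, (P2) follows from the identity theorem
(`MDifferentiable.eq_of_eventually_eq`), and (P3) is Hurwitz's theorem
(`eventually_mem_range_of_tendsto`): a nonconstant map with a value in `X` has a neighbourhood of
maps that are nonconstant and take the same value.
-/

/-! ### Bloch's theorem and Landau's estimate -/

/-- **Bloch's theorem**: the image of a disc of radius larger than `r` under a holomorphic map `g`
contains a disc of radius `r |g'(z₀)| / 48`, where `z₀` is the centre. The disc is found around the
image of a point at which `(r - |z - z₀|) |g'(z)|` is maximal: near such a point `g'` varies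
little by the Schwarz lemma. -/
theorem exists_ball_subset_image_ball {g : ℂ → ℂ} {z₀ : ℂ} {r R : ℝ} (hr : 0 < r) (hrR : r < R)
    (hg : DifferentiableOn ℂ g (Metric.ball z₀ R)) :
    ∃ w, Metric.ball w (r * ‖deriv g z₀‖ / 48) ⊆ g '' Metric.ball z₀ R := by
  have hg' : DifferentiableOn ℂ (deriv g) (Metric.ball z₀ R) := hg.deriv Metric.isOpen_ball
  have hsub : Metric.closedBall z₀ r ⊆ Metric.ball z₀ R := Metric.closedBall_subset_ball hrR
  by_cases h0 : deriv g z₀ = 0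
  · exact ⟨0, by simp [h0]⟩
  have h0' : 0 < ‖deriv g z₀‖ := norm_pos_iff.2 h0
  obtain ⟨z₁, hz₁, hmax⟩ := (isCompact_closedBall z₀ r).exists_isMaxOn
    ⟨z₀, Metric.mem_closedBall_self hr.le⟩
    (f := fun z => (r - dist z z₀) * ‖deriv g z‖)
    ((by fun_prop : Continuous fun z : ℂ => r - dist z z₀).continuousOn.mul
      (hg'.continuousOn.mono hsub).norm)
  rw [isMaxOn_iff] at hmax
  set A := ‖deriv g z₁‖ with hA
  have h1 : r * ‖deriv g z₀‖ ≤ (r - dist z₁ z₀) * A := by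
    simpa using hmax z₀ (Metric.mem_closedBall_self hr.le)
  have hd0 : 0 ≤ r - dist z₁ z₀ := sub_nonneg.2 hz₁
  have hpos : 0 < (r - dist z₁ z₀) * A := lt_of_lt_of_le (by positivity) h1
  obtain ⟨hd, hApos⟩ : 0 < r - dist z₁ z₀ ∧ 0 < A := by
    rcases hd0.eq_or_lt with h | h
    · rw [← h] at hpos; simp at hpos
    · exact ⟨h, (mul_pos_iff_of_pos_left h).1 hpos⟩
  obtain ⟨t, ht⟩ : ∃ t, r - dist z₁ z₀ = 2 * t := ⟨(r - dist z₁ z₀) / 2, by ring⟩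
  have htpos : 0 < t := by linarith
  have hball : Metric.ball z₁ t ⊆ Metric.closedBall z₀ r := fun z hz => by
    have := dist_triangle z z₁ z₀
    rw [Metric.mem_ball] at hz
    rw [Metric.mem_closedBall]; linarith
  -- By maximality `|g'| ≤ 2 A` on the disc of radius `t`, half the distance to the circle.
  have hmaps : MapsTo (deriv g) (Metric.ball z₁ t) (Metric.closedBall (deriv g z₁) (3 * A)) := by
    intro z hz
    have h2 := hmax z (hball hz)
    have h3 : t < r - dist z z₀ := by
      have := dist_triangle z z₁ z₀
      rw [Metric.mem_ball] at hz
      linarith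
    have h4 : ‖deriv g z‖ ≤ 2 * A := by
      have : t * ‖deriv g z‖ ≤ t * (2 * A) :=
        calc t * ‖deriv g z‖ ≤ (r - dist z z₀) * ‖deriv g z‖ := by gcongr
          _ ≤ _ := h2
          _ = t * (2 * A) := by rw [ht]; ring
      exact le_of_mul_le_mul_left this htpos
    rw [Metric.mem_closedBall, dist_eq_norm]
    have := norm_sub_le (deriv g z) (deriv g z₁)
    linarith
  have hschwarz : ∀ z ∈ Metric.ball z₁ t, ‖deriv g z - deriv g z₁‖ ≤ 3 * A / t * dist z z₁ := by
    intro z hz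
    rw [← dist_eq_norm]
    exact Complex.dist_le_div_mul_dist_of_mapsTo_ball (hg'.mono (hball.trans hsub)) hmaps hz
  have hdiff : ∀ z ∈ Metric.ball z₁ t, DifferentiableAt ℂ g z := fun z hz =>
    hg.differentiableAt (Metric.isOpen_ball.mem_nhds (hsub (hball hz)))
  have hst : Metric.closedBall z₁ (t / 6) ⊆ Metric.ball z₁ t :=
    Metric.closedBall_subset_ball (by linarith)
  have hz₁t : z₁ ∈ Metric.closedBall z₁ (t / 6) := Metric.mem_closedBall_self (by positivity)
  have hlow : ∀ z ∈ Metric.sphere z₁ (t / 6), A * t / 12 ≤ ‖g z - g z₁‖ := by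
    intro z hz
    have hz' := Metric.sphere_subset_closedBall hz
    have h5 : ‖(g z - deriv g z₁ * z) - (g z₁ - deriv g z₁ * z₁)‖ ≤ A / 2 * ‖z - z₁‖ := by
      refine (convex_closedBall z₁ (t / 6)).norm_image_sub_le_of_norm_hasDerivWithin_le
        (f := fun z => g z - deriv g z₁ * z) (f' := fun z => deriv g z - deriv g z₁)
        (fun x hx => ?_) (fun x hx => ?_) hz₁t hz'
      · have := (hdiff x (hst hx)).hasDerivAt.sub ((hasDerivAt_id x).const_mul (deriv g z₁))
        rw [mul_one] at this
        exact this.hasDerivWithinAt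
      · calc _ ≤ 3 * A / t * dist x z₁ := hschwarz x (hst hx)
          _ ≤ 3 * A / t * (t / 6) := by gcongr; exact hx
          _ = A / 2 := by field_simp; norm_num
    have h6 : ‖z - z₁‖ = t / 6 := by rw [← dist_eq_norm]; exact hz
    have h7 : ‖deriv g z₁ * (z - z₁)‖ = A * (t / 6) := by rw [norm_mul, h6]
    rw [h6] at h5
    have h8 : ‖deriv g z₁ * (z - z₁)‖ ≤
        ‖g z - g z₁‖ + ‖(g z - deriv g z₁ * z) - (g z₁ - deriv g z₁ * z₁)‖ := by
      refine (congrArg norm ?_).trans_le (norm_sub_le _ _)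
      ring
    linarith
  have hfreq : ∃ᶠ z in 𝓝 z₁, g z ≠ g z₁ := by
    have := (hdiff z₁ (hst hz₁t)).hasDerivAt.eventually_ne (c := g z₁) (norm_pos_iff.1 hApos)
    exact this.frequently.filter_mono nhdsWithin_le_nhds
  have key := DiffContOnCl.ball_subset_image_closedBall
    (DifferentiableOn.diffContOnCl_ball (fun z hz => (hdiff z (hst hz)).differentiableWithinAt)
      (U := Metric.closedBall z₁ (t / 6)) subset_rfl) (by positivity) hlow hfreq
  refine ⟨g z₁, (Metric.ball_subset_ball ?_).trans
    (key.trans (image_mono (hst.trans (hball.trans hsub))))⟩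
  rw [ht] at h1
  linarith

/-- A holomorphic function without zeros on a disc has a holomorphic logarithm there, which takes
the principal value at the centre. -/
theorem exists_exp_eq_on_ball {f : ℂ → ℂ} {z₀ : ℂ} {R : ℝ} (hR : 0 < R)
    (hf : DifferentiableOn ℂ f (Metric.ball z₀ R)) (h0 : ∀ z ∈ Metric.ball z₀ R, f z ≠ 0) :
    ∃ L : ℂ → ℂ, DifferentiableOn ℂ L (Metric.ball z₀ R) ∧ L z₀ = Complex.log (f z₀) ∧
      ∀ z ∈ Metric.ball z₀ R, Complex.exp (L z) = f z := by
  have hz₀ : z₀ ∈ Metric.ball z₀ R := Metric.mem_ball_self hR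
  obtain ⟨L, hL0, hL⟩ := ((hf.deriv Metric.isOpen_ball).div hf h0).isExactOn_ball.with_val_at z₀
    (Complex.log (f z₀))
  refine ⟨L, fun z hz => (hL z hz).differentiableAt.differentiableWithinAt, hL0, ?_⟩
  have hq : ∀ z ∈ Metric.ball z₀ R, HasDerivAt (fun z => Complex.exp (-L z) * f z) 0 z := by
    intro z hz
    have h1 : HasDerivAt L (deriv f z / f z) z := hL z hz
    have h2 : HasDerivAt (fun z => Complex.exp (-L z))
        (Complex.exp (-L z) * -(deriv f z / f z)) z := h1.neg.cexp
    refine (h2.mul (hf.differentiableAt (Metric.isOpen_ball.mem_nhds hz)).hasDerivAt).congr_deriv ?_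
    have := h0 z hz
    field_simp
    ring
  intro z hz
  have hc := (convex_ball z₀ R).norm_image_sub_le_of_norm_hasDerivWithin_le (C := 0)
    (fun x hx => (hq x hx).hasDerivWithinAt) (by simp) hz₀ hz
  rw [zero_mul, norm_le_zero_iff, sub_eq_zero] at hc
  simp only [hL0, Complex.exp_neg, Complex.exp_log (h0 z₀ hz₀)] at hc
  rw [inv_mul_cancel₀ (h0 z₀ hz₀)] at hc
  have := Complex.exp_ne_zero (L z)
  field_simp at hc
  exact hc.symm

theorem exists_sq_eq_on_ball {f : ℂ → ℂ} {z₀ : ℂ} {R : ℝ} (hR : 0 < R)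
    (hf : DifferentiableOn ℂ f (Metric.ball z₀ R)) (h0 : ∀ z ∈ Metric.ball z₀ R, f z ≠ 0) :
    ∃ G : ℂ → ℂ, DifferentiableOn ℂ G (Metric.ball z₀ R) ∧
      ∀ z ∈ Metric.ball z₀ R, G z ^ 2 = f z := by
  obtain ⟨L, hL, -, he⟩ := exists_exp_eq_on_ball hR hf h0
  refine ⟨fun z => Complex.exp (L z / 2), (hL.div_const 2).cexp, fun z hz => ?_⟩
  rw [← he z hz, ← Complex.exp_nat_mul]
  congr 1
  push_cast
  ring

/-- The solutions of `cosh (2 p) = 2 k + 1` with `k ∈ ℕ`, which are the points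
`± arsinh √k + i π n`, meet each disc of radius `2`. -/
theorem exists_cosh_two_mul_eq (w : ℂ) :
    ∃ p ∈ Metric.ball w 2, ∃ k : ℕ, Complex.cosh (2 * p) = 2 * k + 1 := by
  have hre : ∃ x : ℝ, |x - w.re| ≤ 1 ∧ ∃ k : ℕ, Real.cosh (2 * x) = 2 * k + 1 := by
    have hpos : ∀ y : ℝ, 0 ≤ y → ∃ x : ℝ, |x - y| ≤ 1 ∧ ∃ k : ℕ, Real.cosh (2 * x) = 2 * k + 1 := by
      intro y hy
      set k := ⌊Real.sinh y ^ 2⌋₊ with hk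
      have hsq : √(k : ℝ) ^ 2 = k := Real.sq_sqrt (Nat.cast_nonneg _)
      have hs : 0 ≤ Real.sinh y := Real.sinh_nonneg_iff.2 hy
      have hk1 : (k : ℝ) ≤ Real.sinh y ^ 2 := Nat.floor_le (sq_nonneg _)
      have hk2 : Real.sinh y ^ 2 < k + 1 := Nat.lt_floor_add_one _
      set a := Real.arsinh √k with ha
      have hsa : Real.sinh a = √k := Real.sinh_arsinh _
      have hca : Real.cosh a = √(1 + k) := by rw [ha, Real.cosh_arsinh, hsq]
      have h1 : a ≤ y := by
        rw [← Real.sinh_le_sinh, hsa]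
        exact Real.sqrt_le_iff.2 ⟨hs, hk1⟩
      have h2 : y ≤ a + 1 := by
        rw [← Real.sinh_le_sinh, Real.sinh_add]
        have h3 : Real.sinh y ≤ Real.cosh a := by
          rw [hca]; exact Real.le_sqrt_of_sq_le (by linarith)
        have h4 : (1 : ℝ) ≤ Real.sinh 1 := Real.self_le_sinh_iff.2 zero_le_one
        have h5 : 0 ≤ Real.sinh a * Real.cosh 1 := by
          rw [hsa]; exact mul_nonneg (Real.sqrt_nonneg _) (Real.cosh_pos _).le
        nlinarith [Real.cosh_pos a]
      refine ⟨a, abs_le.2 ⟨by linarith, by linarith⟩, k, ?_⟩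
      rw [Real.cosh_two_mul, Real.cosh_sq, hsa, hsq]
      ring
    rcases le_total 0 w.re with h | h
    · exact hpos _ h
    · obtain ⟨x, hx, k, hk⟩ := hpos (-w.re) (neg_nonneg.2 h)
      refine ⟨-x, ?_, k, by rw [mul_neg, Real.cosh_neg, hk]⟩
      rw [← abs_neg]; convert hx using 2; ring
  obtain ⟨x, hx, k, hk⟩ := hre
  have hpi := Real.pi_pos
  have him : |round (w.im / Real.pi) * Real.pi - w.im| ≤ 1.6 := by
    have h1 := abs_sub_round (w.im / Real.pi)
    have h2 : round (w.im / Real.pi) * Real.pi - w.im =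
        -((w.im / Real.pi - round (w.im / Real.pi)) * Real.pi) := by field_simp; ring
    rw [h2, abs_neg, abs_mul, abs_of_pos hpi]
    nlinarith [Real.pi_lt_d2]
  set n := round (w.im / Real.pi)
  refine ⟨x + n * Real.pi * Complex.I, ?_, k, ?_⟩
  · rw [Metric.mem_ball, dist_eq_norm, ← abs_of_pos (zero_lt_two (α := ℝ)), ← abs_norm, ← sq_lt_sq,
      ← Complex.normSq_eq_norm_sq, Complex.normSq_apply]
    have e1 : (x + n * Real.pi * Complex.I - w : ℂ).re = x - w.re := by simp
    have e2 : (x + n * Real.pi * Complex.I - w : ℂ).im = n * Real.pi - w.im := by simp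
    rw [e1, e2]
    have h3 := sq_le_sq' (abs_le.1 hx).1 (abs_le.1 hx).2
    have h4 := sq_le_sq' (abs_le.1 him).1 (abs_le.1 him).2
    nlinarith
  · have e : Complex.cosh (2 * (x + n * Real.pi * Complex.I)) = Complex.cosh (2 * x) := by
      have h := Complex.cos_add_int_mul_two_pi (2 * x * Complex.I) (-n)
      rw [Complex.cos_mul_I] at h
      rw [← h, ← Complex.cos_mul_I]
      congr 1
      push_cast
      linear_combination (2 * n * Real.pi : ℂ) * Complex.I_sq
    rw [e]
    exact_mod_cast congrArg Complex.ofReal hk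

theorem mul_abs_log_le {x : ℝ} (hx : 0 < x) : x * |Real.log x| ≤ 1 + x ^ 2 := by
  have h1 := Real.log_le_sub_one_of_pos hx
  have h2 := Real.one_sub_inv_le_log_of_pos hx
  have h3 : x * x⁻¹ = 1 := mul_inv_cancel₀ hx.ne'
  rcases abs_cases (Real.log x) with ⟨h, -⟩ | ⟨h, -⟩ <;> rw [h] <;> nlinarith

/-- **Landau's theorem** in spherical form: the spherical derivative of a holomorphic function
that omits `0` and `1` on a disc of radius `R` is at most a universal constant times `1 / R` at the
centre of the disc.

With `f = exp (2 π i F)` and `cosh (2 g) = 2 F - 1`, the function `g` omits all solutions of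
`cosh (2 p) = 2 k + 1`, so its image contains no disc of radius `2` and Bloch's theorem
bounds `g'`. -/
theorem norm_deriv_le_of_omits_zero_one {f : ℂ → ℂ} {z₀ : ℂ} {R : ℝ} (hR : 0 < R)
    (hf : DifferentiableOn ℂ f (Metric.ball z₀ R)) (h0 : ∀ z ∈ Metric.ball z₀ R, f z ≠ 0)
    (h1 : ∀ z ∈ Metric.ball z₀ R, f z ≠ 1) :
    ‖deriv f z₀‖ ≤ 4224 / R * (1 + ‖f z₀‖ ^ 2) := by
  have hz₀ : z₀ ∈ Metric.ball z₀ R := Metric.mem_ball_self hR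
  have hpi : (2 * Real.pi * Complex.I : ℂ) ≠ 0 := Complex.two_pi_I_ne_zero
  obtain ⟨L, hL, hL0, hLe⟩ := exists_exp_eq_on_ball hR hf h0
  set F : ℂ → ℂ := fun z => L z / (2 * Real.pi * Complex.I) with hF
  have hFd : DifferentiableOn ℂ F (Metric.ball z₀ R) := hL.div_const _
  have hFint : ∀ z ∈ Metric.ball z₀ R, ∀ n : ℤ, F z ≠ n := by
    intro z hz n hn
    refine h1 z hz ?_
    rw [← hLe z hz, Complex.exp_eq_one_iff]
    exact ⟨n, by rw [← hn, hF]; field_simp⟩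
  obtain ⟨G, hG, hG2⟩ := exists_sq_eq_on_ball hR hFd fun z hz => by simpa using hFint z hz 0
  -- With `F = G ^ 2` and `F - 1 = H ^ 2`, the function `G - H` has no zeros; if
  -- `exp g = G - H`, then `cosh g = G`.
  obtain ⟨H, hH, hH2⟩ := exists_sq_eq_on_ball hR (hFd.sub_const 1) fun z hz =>
    sub_ne_zero.2 (by simpa using hFint z hz 1)
  have hGH : ∀ z ∈ Metric.ball z₀ R, (G z - H z) * (G z + H z) = 1 := fun z hz => by
    linear_combination hG2 z hz - hH2 z hz
  obtain ⟨g, hg, -, hge⟩ := exists_exp_eq_on_ball hR (hG.sub hH) fun z hz =>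
    left_ne_zero_of_mul_eq_one (hGH z hz)
  have hcosh : ∀ z ∈ Metric.ball z₀ R, Complex.cosh (2 * g z) = 2 * F z - 1 := by
    intro z hz
    have e1 : Complex.exp (g z) = G z - H z := hge z hz
    have e2 : Complex.exp (-g z) = G z + H z := by
      rw [Complex.exp_neg, e1]; exact inv_eq_of_mul_eq_one_right (hGH z hz)
    have e3 : Complex.cosh (g z) = G z := by
      rw [Complex.cosh, e1, e2]; ring
    have e4 := Complex.cosh_sq (g z)
    rw [Complex.cosh_two_mul, ← hG2 z hz, ← e3]
    linear_combination -e4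
  -- Bloch's theorem for the radius `R / 2` gives `(R / 2) |g'(z₀)| / 48 < 2`.
  have hgder : ‖deriv g z₀‖ ≤ 192 / R := by
    obtain ⟨w, hw⟩ := exists_ball_subset_image_ball (half_pos hR) (half_lt_self hR) hg
    obtain ⟨p, hp, k, hk⟩ := exists_cosh_two_mul_eq w
    by_contra! hlt
    have h2 : 2 ≤ R / 2 * ‖deriv g z₀‖ / 48 := by
      rw [div_lt_iff₀ hR] at hlt
      linarith
    obtain ⟨z, hz, rfl⟩ := hw (Metric.ball_subset_ball h2 hp)
    refine hFint z hz (k + 1) ?_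
    rw [hcosh z hz] at hk
    push_cast
    linear_combination hk / 2
  have hgz := (hg.differentiableAt (Metric.isOpen_ball.mem_nhds hz₀)).hasDerivAt
  -- On the disc, `f = exp (π i (cosh (2 g) + 1))`.
  have hfeq : f =ᶠ[𝓝 z₀]
      fun z => Complex.exp (Real.pi * Complex.I * (Complex.cosh (2 * g z) + 1)) := by
    filter_upwards [Metric.isOpen_ball.mem_nhds hz₀] with z hz
    rw [hcosh z hz, ← hLe z hz, hF]
    congr 1
    field_simp
    ring
  have hder : deriv f z₀ = 2 * Real.pi * Complex.I * f z₀ * Complex.sinh (2 * g z₀) *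
      deriv g z₀ := by
    rw [hfeq.deriv_eq, hfeq.eq_of_nhds]
    have := (((hgz.const_mul 2).ccosh.add_const 1).const_mul (Real.pi * Complex.I : ℂ)).cexp
    rw [this.deriv]
    ring
  set x := ‖f z₀‖ with hx
  have hxpos : 0 < x := norm_pos_iff.2 (h0 z₀ hz₀)
  have hFn : 2 * Real.pi * ‖F z₀‖ ≤ |Real.log x| + Real.pi := by
    have e : 2 * Real.pi * ‖F z₀‖ = ‖Complex.log (f z₀)‖ := by
      rw [hF, ← hL0, norm_div]
      simp only [norm_mul, Complex.norm_I, Complex.norm_real, Real.norm_eq_abs,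
        abs_of_pos Real.pi_pos, Complex.norm_ofNat]
      have := Real.pi_pos
      field_simp
    rw [e]
    refine (Complex.norm_le_abs_re_add_abs_im _).trans (add_le_add ?_ ?_)
    · rw [Complex.log_re]
    · rw [Complex.log_im]; exact Complex.abs_arg_le_pi _
  have hsinh : ‖Complex.sinh (2 * g z₀)‖ ≤ 2 * ‖F z₀‖ + 2 := by
    have e : Complex.sinh (2 * g z₀) ^ 2 = (2 * F z₀) * (2 * F z₀ - 2) := by
      rw [Complex.sinh_sq, hcosh z₀ hz₀]; ring
    have e2 : ‖Complex.sinh (2 * g z₀)‖ ^ 2 ≤ (2 * ‖F z₀‖ + 2) ^ 2 := by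
      rw [← norm_pow, e, norm_mul, sq]
      have h3 : ‖2 * F z₀‖ = 2 * ‖F z₀‖ := by simp
      have h4 : ‖2 * F z₀ - 2‖ ≤ 2 * ‖F z₀‖ + 2 := by
        refine (norm_sub_le _ _).trans_eq ?_
        simp
      rw [h3]
      gcongr
      linarith
    exact (sq_le_sq₀ (norm_nonneg _) (by positivity)).1 e2
  have hlog := mul_abs_log_le hxpos
  have hR' : 0 ≤ 192 / R := by positivity
  calc ‖deriv f z₀‖ = 2 * Real.pi * x * ‖Complex.sinh (2 * g z₀)‖ * ‖deriv g z₀‖ := by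
        rw [hder]
        simp [abs_of_pos Real.pi_pos, hx]
    _ ≤ 2 * Real.pi * x * (2 * ‖F z₀‖ + 2) * (192 / R) := by
        have := Real.pi_pos
        gcongr
    _ = (2 * x * (2 * Real.pi * ‖F z₀‖) + 4 * Real.pi * x) * (192 / R) := by ring
    _ ≤ (2 * x * (|Real.log x| + Real.pi) + 4 * Real.pi * x) * (192 / R) := by gcongr
    _ ≤ (22 * (1 + x ^ 2)) * (192 / R) := by
        refine mul_le_mul_of_nonneg_right ?_ hR'
        nlinarith [Real.pi_lt_d2, sq_nonneg (x - 1)]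
    _ = 4224 / R * (1 + x ^ 2) := by ring

/-! ### The spherical distance along holomorphic functions -/

/-- A bound for the spherical derivative on a convex set is a Lipschitz constant with respect to
the spherical distance. -/
theorem CHat.dist_coe_le_of_norm_deriv_le {u : ℂ → ℂ} {s : Set ℂ} {K : ℝ} (hs : Convex ℝ s)
    (hu : ∀ z ∈ s, DifferentiableAt ℂ u z)
    (hK : ∀ z ∈ s, ‖deriv u z‖ ≤ K * (1 + ‖u z‖ ^ 2)) {z w : ℂ} (hz : z ∈ s) (hw : w ∈ s) :
    dist (u w : CHat) (u z : CHat) ≤ K * dist w z := by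
  set γ : ℝ → ℂ := fun t => z + t * (w - z) with hγ
  have hγs : ∀ t ∈ Icc (0 : ℝ) 1, γ t ∈ s := fun t ht => by
    have := hs.add_smul_sub_mem hz hw ht
    simpa [hγ] using this
  have hγd : ∀ t, HasDerivAt γ (w - z) t := fun t =>
    (((Complex.ofRealCLM.hasDerivAt (x := t)).mul_const (w - z)).const_add z).congr_deriv (by simp)
  have hv : ∀ t ∈ Icc (0 : ℝ) 1,
      HasDerivAt (fun t => u (γ t)) (deriv u (γ t) * (w - z)) t := fun t ht =>
    (hu _ (hγs t ht)).hasDerivAt.comp t (hγd t)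
  have key := image_le_of_liminf_slope_right_le_deriv_boundary (a := 0) (b := 1)
    (f := fun t => dist (u (γ t) : CHat) (u z : CHat)) (B := fun t => K * dist w z * t)
    (B' := fun _ => K * dist w z) ?_ ?_ (by fun_prop) ?_ ?_ (right_mem_Icc.2 zero_le_one)
  · simpa [hγ] using key
  · have hc : ContinuousOn (fun t => (u (γ t) : CHat)) (Icc 0 1) :=
      OnePoint.continuous_coe.comp_continuousOn
        fun t ht => (hv t ht).continuousAt.continuousWithinAt
    exact continuous_dist.comp_continuousOn (hc.prodMk continuousOn_const)
  · simp [hγ]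
  · intro x _
    simpa using ((hasDerivAt_id x).const_mul (K * dist w z)).hasDerivWithinAt
  · intro t ht r hr
    have ht' := Ico_subset_Icc_self ht
    have hpos : ∀ y : ℂ, 0 < √(1 + ‖y‖ ^ 2) := fun y => by positivity
    have hlim : Tendsto (fun x => ‖slope (fun t => u (γ t)) t x‖ *
        (√(1 + ‖u (γ x)‖ ^ 2) * √(1 + ‖u (γ t)‖ ^ 2))⁻¹) (𝓝[>] t)
        (𝓝 (‖deriv u (γ t) * (w - z)‖ * (√(1 + ‖u (γ t)‖ ^ 2) * √(1 + ‖u (γ t)‖ ^ 2))⁻¹)) := by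
      refine Tendsto.mul ?_ (Tendsto.inv₀ ?_ (mul_pos (hpos _) (hpos _)).ne')
      · exact ((hasDerivAt_iff_tendsto_slope.1 (hv t ht')).mono_left
          (nhdsWithin_mono _ fun x hx => ne_of_gt hx)).norm
      · have hc : ContinuousAt (fun x => √(1 + ‖u (γ x)‖ ^ 2) * √(1 + ‖u (γ t)‖ ^ 2)) t :=
          ((continuousAt_const.add ((hv t ht').continuousAt.norm.pow 2)).sqrt).mul
            continuousAt_const
        exact hc.tendsto.mono_left nhdsWithin_le_nhds
    have hlt : ‖deriv u (γ t) * (w - z)‖ * (√(1 + ‖u (γ t)‖ ^ 2) * √(1 + ‖u (γ t)‖ ^ 2))⁻¹ < r := by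
      refine lt_of_le_of_lt ?_ hr
      rw [Real.mul_self_sqrt (by positivity), norm_mul, ← div_eq_mul_inv,
        div_le_iff₀ (by positivity), dist_eq_norm]
      nlinarith [mul_le_mul_of_nonneg_right (hK _ (hγs t ht')) (norm_nonneg (w - z))]
    refine Eventually.frequently ?_
    filter_upwards [hlim.eventually_lt_const hlt, self_mem_nhdsWithin] with x hx htx
    refine lt_of_le_of_lt ?_ hx
    have hxt : 0 < x - t := sub_pos.2 htx
    have htri := dist_triangle (u (γ x) : CHat) (u (γ t)) (u z)
    rw [slope_def_field, slope_def_module, norm_smul, norm_inv, Real.norm_of_nonneg hxt.le,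
      div_le_iff₀ hxt]
    calc _ ≤ dist (u (γ x) : CHat) (u (γ t)) := by linarith
      _ = _ := by
        rw [CHat.dist_coe_coe]
        field_simp

/-- Holomorphic functions that omit `0` and `1` on a disc are Lipschitz on the concentric disc of
half the radius, with respect to the spherical distance and with a universal constant. -/
theorem CHat.dist_coe_le_of_omits_zero_one {u : ℂ → ℂ} {c : ℂ} {R : ℝ} (hR : 0 < R)
    (hu : DifferentiableOn ℂ u (Metric.ball c (2 * R))) (h0 : ∀ z ∈ Metric.ball c (2 * R), u z ≠ 0)
    (h1 : ∀ z ∈ Metric.ball c (2 * R), u z ≠ 1) {z : ℂ} (hz : z ∈ Metric.ball c R) :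
    dist (u z : CHat) (u c : CHat) ≤ 4224 / R * dist z c := by
  refine CHat.dist_coe_le_of_norm_deriv_le (convex_ball c R) (fun w hw => ?_) (fun w hw => ?_)
    (Metric.mem_ball_self hR) hz
  · exact hu.differentiableAt (Metric.isOpen_ball.mem_nhds
      (Metric.ball_subset_ball (by linarith) hw))
  · have hsub : Metric.ball w R ⊆ Metric.ball c (2 * R) :=
      Metric.ball_subset_ball' (by rw [Metric.mem_ball] at hw; linarith)
    exact norm_deriv_le_of_omits_zero_one hR (hu.mono hsub) (fun x hx => h0 x (hsub hx))
      fun x hx => h1 x (hsub hx)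

/-! ### Möbius transformations -/

namespace CHat

theorem chartZ_mem_atlas : chartZ ∈ atlas ℂ CHat := Or.inl rfl

theorem chartInv_mem_atlas : chartInv ∈ atlas ℂ CHat := Or.inr rfl

theorem coe_chartZ {x : CHat} (hx : x ≠ OnePoint.infty) : (chartZ x : CHat) = x := by
  induction x using OnePoint.rec with
  | infty => exact absurd rfl hx
  | coe z => rw [chartZ_coe]

theorem inversion_ne_infty {x : CHat} (hx : x ≠ ((0 : ℂ) : CHat)) :
    inversion x ≠ OnePoint.infty := fun h =>
  hx (by rw [← inversion_inversion x, h, inversion_infty])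

theorem mdifferentiableAt_chartZ {x : CHat} (hx : x ≠ OnePoint.infty) :
    MDifferentiableAt 𝓘(ℂ) 𝓘(ℂ) chartZ x :=
  mdifferentiableAt_atlas chartZ_mem_atlas (by rw [chartZ_source]; exact hx)

theorem mdifferentiable_coe : MDifferentiable 𝓘(ℂ) 𝓘(ℂ) ((↑) : ℂ → CHat) := fun z =>
  mdifferentiableAt_atlas_symm chartZ_mem_atlas (by rw [chartZ_target]; trivial)

theorem mdifferentiable_inversion : MDifferentiable 𝓘(ℂ) 𝓘(ℂ) inversion := by
  intro x
  by_cases hx : x = OnePoint.infty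
  · have hx0 : x ∈ chartInv.source := by
      rw [chartInv_source, hx]; exact OnePoint.infty_ne_coe _
    refine MDifferentiableAt.congr_of_eventuallyEq (f := fun y => (chartInv y : CHat)) ?_ ?_
    · exact (mdifferentiable_coe _).comp x (mdifferentiableAt_atlas chartInv_mem_atlas hx0)
    · filter_upwards [chartInv.open_source.mem_nhds hx0] with y hy
      rw [chartInv_source] at hy
      exact (coe_chartZ (inversion_ne_infty hy)).symm
  · have hx0 : x ∈ chartZ.source := by rw [chartZ_source]; exact hx
    refine MDifferentiableAt.congr_of_eventuallyEq (f := fun y => chartInv.symm (chartZ y)) ?_ ?_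
    · exact MDifferentiableAt.comp x
        (mdifferentiableAt_atlas_symm chartInv_mem_atlas (by rw [chartInv_target]; trivial))
        (mdifferentiableAt_chartZ hx)
    · filter_upwards [chartZ.open_source.mem_nhds hx0] with y hy
      rw [chartZ_source] at hy
      rw [chartInv_symm, coe_chartZ hy]

/-- The affine map `z ↦ α z + β` of `ℂ ∪ {∞}`, which fixes `∞`. -/
noncomputable def affine (α β : ℂ) (hα : α ≠ 0) : CHat ≃ₜ CHat :=
  (affineHomeomorph α β hα).onePointCongr

theorem affine_coe {α β : ℂ} (hα : α ≠ 0) (z : ℂ) :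
    affine α β hα (z : CHat) = ((α * z + β : ℂ) : CHat) := rfl

theorem affine_infty {α β : ℂ} (hα : α ≠ 0) :
    affine α β hα OnePoint.infty = OnePoint.infty := rfl

theorem mdifferentiable_affine {α β : ℂ} (hα : α ≠ 0) :
    MDifferentiable 𝓘(ℂ) 𝓘(ℂ) (affine α β hα) := by
  intro x
  by_cases hx : x = OnePoint.infty
  · -- In the coordinate `w = 1 / z` the map is `w ↦ w / (α + β w)`.
    subst hx
    refine MDifferentiableAt.congr_of_eventuallyEq
      (f := fun y => inversion ((chartZ (inversion y) / (α + β * chartZ (inversion y)) : ℂ) : CHat))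
      ?_ ?_
    · have h1 : MDifferentiableAt 𝓘(ℂ) 𝓘(ℂ) (fun y => chartZ (inversion y)) OnePoint.infty :=
        (mdifferentiableAt_chartZ (inversion_ne_infty (OnePoint.infty_ne_coe _))).comp _
          (mdifferentiable_inversion _)
      have h2 : DifferentiableAt ℂ (fun w => w / (α + β * w)) (chartZ (inversion OnePoint.infty)) := by
        refine DifferentiableAt.div (by fun_prop) (by fun_prop) ?_
        rw [inversion_infty, chartZ_coe]
        simpa using hα
      exact (mdifferentiable_inversion _).comp _ ((mdifferentiable_coe _).comp _
        (h2.mdifferentiableAt.comp OnePoint.infty h1))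
    · have hop : ∀ w : ℂ, ∀ᶠ y : CHat in 𝓝 OnePoint.infty, y ≠ (w : CHat) := fun w =>
        isOpen_ne.mem_nhds (OnePoint.infty_ne_coe w)
      filter_upwards [hop 0, hop (-β / α)] with y hy hy'
      induction y using OnePoint.rec with
      | infty => simp [inversion_infty, chartZ_coe, inversion_zero, affine_infty]
      | coe z =>
        have hz : z ≠ 0 := fun h => hy (by rw [h])
        have hz' : α * z + β ≠ 0 := fun h => hy' (by
          congr 1; field_simp; linear_combination h)
        have e : z⁻¹ / (α + β * z⁻¹) = (α * z + β)⁻¹ := by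
          have : α + β * z⁻¹ ≠ 0 := by
            intro h; apply hz'; field_simp at h; simpa using h
          field_simp
        rw [inversion_coe hz, chartZ_coe, e, inversion_coe (inv_ne_zero hz'), inv_inv, affine_coe]
  · refine MDifferentiableAt.congr_of_eventuallyEq
      (f := fun y => ((α * chartZ y + β : ℂ) : CHat)) ?_ ?_
    · have h2 : DifferentiableAt ℂ (fun w => α * w + β) (chartZ x) := by fun_prop
      exact (mdifferentiable_coe _).comp _
        (h2.mdifferentiableAt.comp x (mdifferentiableAt_chartZ hx))
    · filter_upwards [isOpen_ne.mem_nhds hx] with y hy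
      rw [← affine_coe hα, coe_chartZ hy]

/-- The Möbius group acts transitively on triples of distinct points. -/
theorem exists_homeomorph_mdifferentiable {a b c : CHat} (hab : a ≠ b) (hac : a ≠ c)
    (hbc : b ≠ c) : ∃ T : CHat ≃ₜ CHat, MDifferentiable 𝓘(ℂ) 𝓘(ℂ) T ∧ T a = OnePoint.infty ∧
      T b = ((0 : ℂ) : CHat) ∧ T c = ((1 : ℂ) : CHat) := by
  obtain ⟨T₁, hT₁, ha⟩ : ∃ T : CHat ≃ₜ CHat, MDifferentiable 𝓘(ℂ) 𝓘(ℂ) T ∧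
      T a = OnePoint.infty := by
    induction a using OnePoint.rec with
    | infty => exact ⟨Homeomorph.refl _, mdifferentiable_id, rfl⟩
    | coe z =>
      refine ⟨(affine 1 (-z) one_ne_zero).trans inversionHomeomorph,
        mdifferentiable_inversion.comp (mdifferentiable_affine one_ne_zero), ?_⟩
      change inversion (affine 1 (-z) one_ne_zero (z : CHat)) = _
      rw [affine_coe, one_mul, add_neg_cancel, inversion_zero]
  obtain ⟨b', hb⟩ := OnePoint.ne_infty_iff_exists.1 (ha ▸ T₁.injective.ne hab.symm)
  obtain ⟨c', hc⟩ := OnePoint.ne_infty_iff_exists.1 (ha ▸ T₁.injective.ne hac.symm)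
  have hbc' : c' - b' ≠ 0 := sub_ne_zero.2 fun h => hbc (T₁.injective (by rw [← hb, ← hc, h]))
  refine ⟨T₁.trans (affine (c' - b')⁻¹ (-(c' - b')⁻¹ * b') (inv_ne_zero hbc')),
    (mdifferentiable_affine _).comp hT₁, ?_, ?_, ?_⟩
  · rw [Homeomorph.trans_apply, ha, affine_infty]
  · rw [Homeomorph.trans_apply, ← hb, affine_coe]
    congr 1; ring
  · rw [Homeomorph.trans_apply, ← hc, affine_coe]
    congr 1; field_simp; ring

end CHat

/-! ### Local behaviour of holomorphic maps to the extended plane -/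

section HolomorphicMaps

variable {M : Type*} [TopologicalSpace M] [ChartedSpace ℂ M]

/-- A map `f` from a Riemann surface to `ℂ ∪ {∞}`, written in the chart at `p` and the chart `z` of
`ℂ ∪ {∞}`. It is meaningful only at points where `f` is finite. -/
noncomputable def localRep (f : M → CHat) (p : M) (z : ℂ) : ℂ :=
  CHat.chartZ (f ((chartAt ℂ p).symm z))

theorem localRep_chartAt {f : M → CHat} {p x : M} (hx : x ∈ (chartAt ℂ p).source) :
    localRep f p (chartAt ℂ p x) = CHat.chartZ (f x) := by
  rw [localRep, (chartAt ℂ p).left_inv hx]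

theorem coe_localRep {f : M → CHat} {p : M} {z : ℂ}
    (hf : f ((chartAt ℂ p).symm z) ≠ OnePoint.infty) :
    (localRep f p z : CHat) = f ((chartAt ℂ p).symm z) := CHat.coe_chartZ hf

/-- The chart at `p` maps some subset of a given neighbourhood of `p` onto a closed disc. -/
theorem exists_closedBall_chartAt {U : Set M} {p : M} (hU : U ∈ 𝓝 p) : ∃ r > 0,
    Metric.closedBall (chartAt ℂ p p) r ⊆ (chartAt ℂ p).target ∩ (chartAt ℂ p).symm ⁻¹' U := by
  refine Metric.nhds_basis_closedBall.mem_iff.1 (inter_mem ?_ ?_)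
  · exact (chartAt ℂ p).open_target.mem_nhds ((chartAt ℂ p).map_source (mem_chart_source ℂ p))
  · have := (chartAt ℂ p).continuousAt_symm ((chartAt ℂ p).map_source (mem_chart_source ℂ p))
    apply this
    rwa [(chartAt ℂ p).left_inv (mem_chart_source ℂ p)]

theorem isCompact_chartAt_symm_image {p : M} {s : Set ℂ} (hs : IsCompact s)
    (h : s ⊆ (chartAt ℂ p).target) : IsCompact ((chartAt ℂ p).symm '' s) :=
  hs.image_of_continuousOn ((chartAt ℂ p).continuousOn_symm.mono h)

/-- Locally uniform convergence with respect to the spherical distance is locally uniform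
convergence in the chart `z` where the limit is finite. -/
theorem tendstoUniformlyOn_chartZ {X ι : Type*} [TopologicalSpace X] {l : Filter ι}
    {F : ι → C(X, CHat)} {f : C(X, CHat)} (h : Tendsto F l (𝓝 f)) {K : Set X} (hK : IsCompact K)
    (hf : ∀ x ∈ K, f x ≠ OnePoint.infty) :
    (∀ᶠ i in l, ∀ x ∈ K, F i x ≠ OnePoint.infty) ∧
      TendstoUniformlyOn (fun i x => CHat.chartZ (F i x)) (fun x => CHat.chartZ (f x)) l K := by
  rw [ContinuousMap.tendsto_iff_forall_isCompact_tendstoUniformlyOn] at h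
  have hsub : f '' K ⊆ CHat.chartZ.source := by
    rintro _ ⟨x, hx, rfl⟩
    rw [CHat.chartZ_source]
    exact hf x hx
  obtain ⟨δ, hδ, hsub'⟩ := (hK.image f.continuous).exists_cthickening_subset_open
    CHat.chartZ.open_source hsub
  have hev : ∀ᶠ i in l, ∀ x ∈ K, F i x ∈ Metric.cthickening δ (f '' K) := by
    filter_upwards [Metric.tendstoUniformlyOn_iff.1 (h K hK) δ hδ] with i hi x hx
    refine Metric.mem_cthickening_of_dist_le _ _ _ _ (mem_image_of_mem f hx) ?_
    rw [dist_comm]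
    exact (hi x hx).le
  constructor
  · filter_upwards [hev] with i hi x hx
    have := hsub' (hi x hx)
    rwa [CHat.chartZ_source] at this
  · refine UniformContinuousOn.comp_tendstoUniformlyOn_eventually hev
      (fun x hx => Metric.self_subset_cthickening _ (mem_image_of_mem f hx)) ?_ (h K hK)
    exact Metric.isClosed_cthickening.isCompact.uniformContinuousOn_of_continuous
      (CHat.chartZ.continuousOn.mono hsub')

theorem tendstoUniformlyOn_localRep {ι : Type*} {l : Filter ι}
    {F : ι → C(M, CHat)} {f : C(M, CHat)} (h : Tendsto F l (𝓝 f)) {p : M} {s : Set ℂ}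
    (hs : IsCompact s) (hst : s ⊆ (chartAt ℂ p).target)
    (hf : ∀ z ∈ s, f ((chartAt ℂ p).symm z) ≠ OnePoint.infty) :
    (∀ᶠ i in l, ∀ z ∈ s, F i ((chartAt ℂ p).symm z) ≠ OnePoint.infty) ∧
      TendstoUniformlyOn (fun i => localRep (F i) p) (localRep f p) l s := by
  obtain ⟨h1, h2⟩ := tendstoUniformlyOn_chartZ h (isCompact_chartAt_symm_image hs hst)
    (by rintro _ ⟨z, hz, rfl⟩; exact hf z hz)
  exact ⟨h1.mono fun i hi z hz => hi _ (mem_image_of_mem _ hz),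
    (h2.comp (chartAt ℂ p).symm).mono (subset_preimage_image _ _)⟩

variable [IsManifold 𝓘(ℂ) ω M]

theorem MDifferentiable.differentiableAt_localRep {f : M → CHat} (hf : MDifferentiable 𝓘(ℂ) 𝓘(ℂ) f)
    {p : M} {z : ℂ} (hz : z ∈ (chartAt ℂ p).target)
    (hfz : f ((chartAt ℂ p).symm z) ≠ OnePoint.infty) : DifferentiableAt ℂ (localRep f p) z := by
  rw [← mdifferentiableAt_iff_differentiableAt]
  exact (CHat.mdifferentiableAt_chartZ hfz).comp z
    ((hf _).comp z (mdifferentiableAt_atlas_symm (chart_mem_atlas ℂ p) hz))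

theorem mdifferentiableAt_of_differentiableAt_localRep {f : M → CHat} (hc : Continuous f) {p : M}
    (hp : f p ≠ OnePoint.infty) (h : DifferentiableAt ℂ (localRep f p) (chartAt ℂ p p)) :
    MDifferentiableAt 𝓘(ℂ) 𝓘(ℂ) f p := by
  refine MDifferentiableAt.congr_of_eventuallyEq
    (f := fun x => (localRep f p (chartAt ℂ p x) : CHat)) ?_ ?_
  · exact (CHat.mdifferentiable_coe _).comp p (h.mdifferentiableAt.comp p
      (mdifferentiableAt_atlas (chart_mem_atlas ℂ p) (mem_chart_source ℂ p)))
  · filter_upwards [(chartAt ℂ p).open_source.mem_nhds (mem_chart_source ℂ p),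
      hc.continuousAt.eventually_ne hp] with x hx hx'
    rw [localRep_chartAt hx, CHat.coe_chartZ hx']

/-- Locally, a holomorphic map takes the value `f p` either everywhere or only at `p`. -/
theorem MDifferentiable.eventually_eq_or_eventually_ne {f : M → CHat}
    (hf : MDifferentiable 𝓘(ℂ) 𝓘(ℂ) f) (p : M) :
    (∀ᶠ x in 𝓝 p, f x = f p) ∨ ∀ᶠ x in 𝓝[≠] p, f x ≠ f p := by
  -- A pole becomes a zero after composition with `z ↦ 1 / z`.
  wlog hp : f p ≠ OnePoint.infty generalizing f
  · have := this (CHat.mdifferentiable_inversion.comp hf) (CHat.inversion_ne_infty (by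
      rw [not_not.1 hp]; exact OnePoint.infty_ne_coe _))
    simpa only [Function.comp_apply, ne_eq, CHat.inversionHomeomorph.injective.eq_iff,
      show CHat.inversion = CHat.inversionHomeomorph from rfl] using this
  have hps := mem_chart_source ℂ p
  have hU : {x | f x ≠ OnePoint.infty} ∈ 𝓝 p := hf.continuous.continuousAt.eventually_ne hp
  obtain ⟨r, hr, hball⟩ := exists_closedBall_chartAt hU
  have han : AnalyticAt ℂ (localRep f p) (chartAt ℂ p p) := by
    have hd : DifferentiableOn ℂ (localRep f p) (Metric.closedBall (chartAt ℂ p p) r) :=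
      fun z hz => (hf.differentiableAt_localRep (hball hz).1
        (hball hz).2).differentiableWithinAt
    exact hd.analyticAt (Metric.closedBall_mem_nhds _ hr)
  have hφ := (chartAt ℂ p).continuousAt hps
  have hev : ∀ᶠ x in 𝓝 p, f x = f p ↔
      localRep f p (chartAt ℂ p x) = localRep f p (chartAt ℂ p p) := by
    filter_upwards [(chartAt ℂ p).open_source.mem_nhds hps, hU] with x hx hx'
    rw [localRep_chartAt hx, localRep_chartAt hps, ← OnePoint.coe_eq_coe (X := ℂ), CHat.coe_chartZ hx',
      CHat.coe_chartZ hp]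
  rcases han.eventually_eq_or_eventually_ne
    (analyticAt_const (v := localRep f p (chartAt ℂ p p))) with h | h
  · left
    filter_upwards [hev, hφ.eventually h] with x hx hx'
    exact hx.2 hx'
  · right
    have ht : Tendsto (chartAt ℂ p) (𝓝[≠] p) (𝓝[≠] (chartAt ℂ p p)) := by
      refine tendsto_nhdsWithin_iff.2 ⟨hφ.tendsto.mono_left nhdsWithin_le_nhds, ?_⟩
      filter_upwards [nhdsWithin_le_nhds ((chartAt ℂ p).open_source.mem_nhds hps),
        self_mem_nhdsWithin] with x hx hx'
      exact fun h => hx' ((chartAt ℂ p).injOn hx hps h)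
    filter_upwards [nhdsWithin_le_nhds hev, ht.eventually h] with x hx hx'
    exact fun h => hx' (hx.1 h)

/-- The **identity theorem**: a holomorphic map on a connected Riemann surface that is constant near
a point is constant. -/
theorem MDifferentiable.eq_of_eventually_eq [ConnectedSpace M] {f : M → CHat}
    (hf : MDifferentiable 𝓘(ℂ) 𝓘(ℂ) f) {p : M} (hp : ∀ᶠ x in 𝓝 p, f x = f p) (q : M) :
    f q = f p := by
  have hopen : IsOpen {q | ∀ᶠ x in 𝓝 q, f x = f p} := isOpen_setOfPred_eventually_nhds
  have hclosed : IsClosed {q | ∀ᶠ x in 𝓝 q, f x = f p} := by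
    refine isClosed_of_closure_subset fun q hq => ?_
    have hfq : f q = f p :=
      closure_minimal (fun x hx => hx.self_of_nhds) (isClosed_eq hf.continuous continuous_const) hq
    by_contra hqA
    rw [← hfq] at hqA
    have hne := (hf.eventually_eq_or_eventually_ne q).resolve_left (by
      simpa [hfq] using hqA)
    rw [eventually_nhdsWithin_iff] at hne
    obtain ⟨x, hx, hxA⟩ := mem_closure_iff_nhds.1 hq _ hne
    refine hx (fun h => ?_) (by rw [hxA.self_of_nhds, hfq])
    rw [h] at hxA
    rw [hfq] at hqA
    exact hqA hxA
  have hq : q ∈ {q | ∀ᶠ x in 𝓝 q, f x = f p} :=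
    (IsClopen.eq_univ ⟨hclosed, hopen⟩ ⟨p, hp⟩).symm ▸ mem_univ q
  have hq' : {x | f x = f p} ∈ 𝓝 q := hq
  exact (mem_of_mem_nhds hq' : q ∈ {x | f x = f p})

/-! ### Limits of holomorphic maps -/

theorem tendsto_inversion_comp {X ι : Type*} [TopologicalSpace X] {l : Filter ι}
    {F : ι → C(X, CHat)} {f : C(X, CHat)} (h : Tendsto F l (𝓝 f)) :
    Tendsto (fun i => (⟨CHat.inversion, CHat.continuous_inversion⟩ : C(CHat, CHat)).comp (F i)) l
      (𝓝 ((⟨CHat.inversion, CHat.continuous_inversion⟩ : C(CHat, CHat)).comp f)) :=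
  ((ContinuousMap.continuous_postcomp _).tendsto f).comp h

/-- **Weierstrass's theorem** for the spherical distance: locally uniform limits of holomorphic maps
are holomorphic. -/
theorem mdifferentiable_of_tendsto {ι : Type*} {l : Filter ι} [l.NeBot]
    {F : ι → C(M, CHat)} {f : C(M, CHat)} (h : Tendsto F l (𝓝 f))
    (hF : ∀ i, MDifferentiable 𝓘(ℂ) 𝓘(ℂ) (F i)) : MDifferentiable 𝓘(ℂ) 𝓘(ℂ) f := by
  intro p
  -- A pole becomes a zero after composition with `z ↦ 1 / z`.
  wlog hp : f p ≠ OnePoint.infty generalizing f F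
  · have := this (tendsto_inversion_comp h) (fun i => CHat.mdifferentiable_inversion.comp (hF i))
      (CHat.inversion_ne_infty (by rw [not_not.1 hp]; exact OnePoint.infty_ne_coe _))
    refine ((CHat.mdifferentiable_inversion _).comp p this).congr_of_eventuallyEq
      (Eventually.of_forall fun x => ?_)
    exact (CHat.inversion_inversion _).symm
  have hU : {x | f x ≠ OnePoint.infty} ∈ 𝓝 p := f.continuous.continuousAt.eventually_ne hp
  obtain ⟨r, hr, hball⟩ := exists_closedBall_chartAt hU
  obtain ⟨h1, h2⟩ := tendstoUniformlyOn_localRep h (isCompact_closedBall (chartAt ℂ p p) r)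
    (fun z hz => (hball hz).1) fun z hz => (hball hz).2
  have hd : DifferentiableOn ℂ (localRep f p) (Metric.ball (chartAt ℂ p p) r) := by
    refine (h2.mono Metric.ball_subset_closedBall).tendstoLocallyUniformlyOn.differentiableOn ?_
      Metric.isOpen_ball
    filter_upwards [h1] with i hi z hz
    have hz' := Metric.ball_subset_closedBall hz
    exact ((hF i).differentiableAt_localRep (hball hz').1 (hi z hz')).differentiableWithinAt
  exact mdifferentiableAt_of_differentiableAt_localRep f.continuous hp
    (hd.differentiableAt (Metric.ball_mem_nhds _ hr))

/-- If `u` takes the value `u c` on a closed disc only at its centre `c`, then holomorphic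
functions uniformly close to `u` on the disc take the value `u c` too. -/
theorem eventually_mem_image_of_tendstoUniformlyOn {ι : Type*} {l : Filter ι} {v : ι → ℂ → ℂ}
    {u : ℂ → ℂ} {c : ℂ} {r : ℝ} (hr : 0 < r)
    (hv : ∀ᶠ i in l, DifferentiableOn ℂ (v i) (Metric.ball c (2 * r)))
    (hu : ContinuousOn u (Metric.closedBall c r))
    (hne : ∀ z ∈ Metric.closedBall c r, z ≠ c → u z ≠ u c)
    (h : TendstoUniformlyOn v u l (Metric.closedBall c r)) :
    ∀ᶠ i in l, ∃ z ∈ Metric.closedBall c r, v i z = u c := by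
  have hsc : Metric.sphere c r ⊆ Metric.closedBall c r := Metric.sphere_subset_closedBall
  have hne' : (Metric.sphere c r).Nonempty := NormedSpace.sphere_nonempty.2 hr.le
  obtain ⟨z₁, hz₁, hmin⟩ := (isCompact_sphere c r).exists_isMinOn hne'
    ((hu.mono hsc).sub continuousOn_const).norm (f := fun z => ‖u z - u c‖)
  have hε : 0 < ‖u z₁ - u c‖ := norm_pos_iff.2 (sub_ne_zero.2
    (hne z₁ (hsc hz₁) (Metric.ne_of_mem_sphere hz₁ hr.ne')))
  set ε := ‖u z₁ - u c‖
  have hc : c ∈ Metric.closedBall c r := Metric.mem_closedBall_self hr.le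
  filter_upwards [hv, Metric.tendstoUniformlyOn_iff.1 h (ε / 8) (by positivity)] with i hvi hi
  simp only [dist_eq_norm] at hi
  have hbc : Metric.closedBall c r ⊆ Metric.ball c (2 * r) :=
    Metric.closedBall_subset_ball (by linarith)
  have hlow : ∀ z ∈ Metric.sphere c r, ε / 2 ≤ ‖v i z - v i c‖ := by
    intro z hz
    have h1 : ε ≤ ‖u z - u c‖ := hmin hz
    have h2 := hi z (hsc hz)
    have h3 := hi c hc
    have h4 : ‖u z - u c‖ ≤ ‖u z - v i z‖ + ‖v i z - v i c‖ + ‖u c - v i c‖ := by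
      rw [norm_sub_rev (u c)]
      refine (congrArg norm ?_).trans_le norm_add₃_le
      ring
    linarith
  -- The disc of radius `2 r` serves here: constancy near `c` would extend to the circle.
  have hfreq : ∃ᶠ z in 𝓝 c, v i z ≠ v i c := by
    intro hev
    simp only [not_not] at hev
    obtain ⟨z, hz⟩ := hne'
    have heq := (hvi.analyticOnNhd Metric.isOpen_ball).eqOn_of_preconnected_of_eventuallyEq
      analyticOnNhd_const (convex_ball c (2 * r)).isPreconnected (hbc hc) hev (hbc (hsc hz))
    have := hlow z hz
    rw [heq] at this
    simp only [sub_self, norm_zero] at this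
    linarith
  have hmem : u c ∈ Metric.ball (v i c) (ε / 2 / 2) := by
    rw [Metric.mem_ball, dist_eq_norm]
    have := hi c hc
    linarith
  exact (hvi.diffContOnCl_ball hbc).ball_subset_image_closedBall hr hlow hfreq hmem

/-- **Hurwitz's theorem**: the values of a nonconstant holomorphic map are taken by all holomorphic
maps close to it. -/
theorem eventually_mem_range_of_tendsto {ι : Type*} {l : Filter ι}
    {F : ι → C(M, CHat)} {f : C(M, CHat)} (h : Tendsto F l (𝓝 f))
    (hF : ∀ i, MDifferentiable 𝓘(ℂ) 𝓘(ℂ) (F i)) (hf : MDifferentiable 𝓘(ℂ) 𝓘(ℂ) f) {p : M}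
    (hp : ¬ ∀ᶠ x in 𝓝 p, f x = f p) : ∀ᶠ i in l, f p ∈ range (F i) := by
  -- A pole becomes a zero after composition with `z ↦ 1 / z`.
  wlog hp' : f p ≠ OnePoint.infty generalizing f F
  · have hinj := CHat.inversionHomeomorph.injective
    have := this (tendsto_inversion_comp h) (fun i => CHat.mdifferentiable_inversion.comp (hF i))
      (CHat.mdifferentiable_inversion.comp hf)
      (fun hev => hp (hev.mono fun x hx => hinj hx))
      (CHat.inversion_ne_infty (by rw [not_not.1 hp']; exact OnePoint.infty_ne_coe _))
    filter_upwards [this] with i hi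
    obtain ⟨x, hx⟩ := hi
    exact ⟨x, hinj hx⟩
  have hps := mem_chart_source ℂ p
  have hU : {x | f x ≠ OnePoint.infty ∧ (x ≠ p → f x ≠ f p)} ∈ 𝓝 p :=
    (hf.continuous.continuousAt.eventually_ne hp').and (eventually_nhdsWithin_iff.1
      ((hf.eventually_eq_or_eventually_ne p).resolve_left hp))
  obtain ⟨r, hr, hball⟩ := exists_closedBall_chartAt hU
  obtain ⟨h1, h2⟩ := tendstoUniformlyOn_localRep h (isCompact_closedBall (chartAt ℂ p p) r)
    (fun z hz => (hball hz).1) fun z hz => (hball hz).2.1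
  have hsub : Metric.closedBall (chartAt ℂ p p) (r / 2) ⊆ Metric.closedBall (chartAt ℂ p p) r :=
    Metric.closedBall_subset_closedBall (by linarith)
  have hcp : (localRep f p (chartAt ℂ p p) : CHat) = f p := by
    rw [localRep_chartAt hps, CHat.coe_chartZ hp']
  have key := eventually_mem_image_of_tendstoUniformlyOn (half_pos hr) (v := fun i => localRep (F i) p)
    (u := localRep f p) (c := chartAt ℂ p p) (l := l) ?_ ?_ ?_ (h2.mono hsub)
  · filter_upwards [key, h1] with i hi hi1
    obtain ⟨z, hz, hiz⟩ := hi
    refine ⟨(chartAt ℂ p).symm z, ?_⟩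
    rw [← coe_localRep (hi1 z (hsub hz)), hiz, hcp]
  · filter_upwards [h1] with i hi z hz
    rw [mul_div_cancel₀ _ two_ne_zero] at hz
    have hz' := Metric.ball_subset_closedBall hz
    exact ((hF i).differentiableAt_localRep (hball hz').1 (hi z hz')).differentiableWithinAt
  · exact fun z hz => (hf.differentiableAt_localRep (hball (hsub hz)).1
      (hball (hsub hz)).2.1).continuousAt.continuousWithinAt
  · intro z hz hzc heq
    have hb := hball (hsub hz)
    refine hb.2.2 (fun h => hzc ?_) ?_
    · rw [← (chartAt ℂ p).right_inv hb.1, h]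
    · rw [← coe_localRep hb.2.1, heq, hcp]

end HolomorphicMaps

/-! ### Equicontinuity of the maps that omit three values -/

/-- The holomorphic maps that omit three fixed values or are constant are equicontinuous with respect
to the spherical distance: a Möbius transformation moves the three values to `∞`, `0`, `1`, and
Landau's theorem gives a common Lipschitz constant on a coordinate disc. -/
theorem equicontinuousAt_of_mem_omitProperty {S : RiemannSurface.{u}} {X : Set CHat} {a b c : CHat}
    (ha : a ∈ X) (hb : b ∈ X) (hc : c ∈ X) (hab : a ≠ b) (hac : a ≠ c) (hbc : b ≠ c) (p : S) :
    EquicontinuousAt (fun f : omitProperty.{u} X S => (f : HolMap S).1) p := by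
  obtain ⟨T, hT, hTa, hTb, hTc⟩ := CHat.exists_homeomorph_mdifferentiable hab hac hbc
  have hTu : UniformContinuous T.symm :=
    CompactSpace.uniformContinuous_of_continuous T.symm.continuous
  rw [Metric.equicontinuousAt_iff_right]
  intro ε hε
  obtain ⟨δ, hδ, hTδ⟩ := Metric.uniformContinuous_iff.1 hTu ε hε
  have hps := mem_chart_source ℂ p
  obtain ⟨r, hr, hball⟩ := exists_closedBall_chartAt (p := p) univ_mem
  have hφ := (chartAt ℂ p).continuousAt hps
  have hlim : Tendsto (fun x => 4224 / (r / 2) * dist (chartAt ℂ p x) (chartAt ℂ p p)) (𝓝 p) (𝓝 0) := by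
    have := (hφ.tendsto.dist (tendsto_const_nhds (x := chartAt ℂ p p))).const_mul (4224 / (r / 2))
    simpa using this
  filter_upwards [(chartAt ℂ p).open_source.mem_nhds hps, hlim.eventually_lt_const hδ,
    hφ.preimage_mem_nhds (Metric.ball_mem_nhds _ (half_pos hr))] with x hx hxδ hxr
  rintro ⟨f, hf⟩
  rcases hf with hf | ⟨w, hw⟩
  · have homit : ∀ y ∈ X, ∀ q, T (f q) ≠ T y := fun y hy q h =>
      hf (mem_range_self q) (T.injective h ▸ hy)
    have hTf : MDifferentiable 𝓘(ℂ) 𝓘(ℂ) fun q => T (f q) := hT.comp f.2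
    have hinf : ∀ q, T (f q) ≠ OnePoint.infty := fun q => hTa ▸ homit a ha q
    have hcoe : ∀ z, (localRep (fun q => T (f q)) p z : CHat) = T (f ((chartAt ℂ p).symm z)) :=
      fun z => coe_localRep (f := fun q => T (f q)) (hinf _)
    have key := CHat.dist_coe_le_of_omits_zero_one (half_pos hr)
      (u := localRep (fun q => T (f q)) p) (c := chartAt ℂ p p) (fun z hz => ?_)
      (fun z _ h0 => homit b hb _ (by rw [← hcoe z, h0, hTb]))
      (fun z _ h1 => homit c hc _ (by rw [← hcoe z, h1, hTc])) hxr
    · rw [hcoe, hcoe, (chartAt ℂ p).left_inv hx, (chartAt ℂ p).left_inv hps] at key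
      have := hTδ (key.trans_lt hxδ)
      rwa [T.symm_apply_apply, T.symm_apply_apply, dist_comm] at this
    · rw [mul_div_cancel₀ _ two_ne_zero] at hz
      exact (hTf.differentiableAt_localRep (hball (Metric.ball_subset_closedBall hz)).1
        (hinf _)).differentiableWithinAt
  · change dist (f p) (f x) < ε
    rwa [hw, hw, dist_self]

/-- A special case of the **Arzelà–Ascoli theorem**: in an equicontinuous sequence of maps from a
Riemann surface to `ℂ ∪ {∞}` some subsequence converges locally uniformly. -/
theorem exists_tendsto_subseq_of_equicontinuous {S : RiemannSurface.{u}} (F : ℕ → C(S, CHat))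
    (hF : Equicontinuous fun n => (F n : S → CHat)) :
    ∃ g : C(S, CHat), ∃ k : ℕ → ℕ, StrictMono k ∧ Tendsto (F ∘ k) atTop (𝓝 g) := by
  have : LocallyCompactSpace S := ChartedSpace.locallyCompactSpace ℂ S
  have hemb : IsClosedEmbedding (UniformOnFun.ofFun {K : Set S | IsCompact K} ∘
      fun f : C(S, CHat) => (f : S → CHat)) := by
    have hu := ContinuousMap.isUniformEmbedding_toUniformOnFunIsCompact (α := S) (β := CHat)
    refine ⟨hu.isEmbedding, ?_⟩
    have : T2Space (UniformOnFun S CHat {K : Set S | IsCompact K}) :=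
      UniformOnFun.t2Space_of_covering (sUnion_eq_univ_iff.2 fun x => ⟨{x}, isCompact_singleton, rfl⟩)
    exact (completeSpace_iff_isComplete_range hu.isUniformInducing).1 inferInstance |>.isClosed
  have hcomp : IsCompact (closure (range F)) := by
    refine ArzelaAscoli.isCompact_closure_of_isClosedEmbedding (fun K hK => hK) hemb
      (fun K _ => ?_) fun K _ x _ => ⟨univ, isCompact_univ, fun _ _ => mem_univ _⟩
    refine Equicontinuous.equicontinuousOn (fun x U hU => ?_) K
    filter_upwards [hF x U hU] with y hy
    rintro ⟨_, n, rfl⟩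
    exact hy n
  obtain ⟨g, -, k, hk, hg⟩ := hcomp.tendsto_subseq fun n => subset_closure (mem_range_self n)
  exact ⟨g, k, hk, hg⟩

/-! ### The axioms of a closed and of a compact property -/

theorem isClosedProperty_omitProperty (X : Set CHat) :
    IsClosedProperty.{u} (omitProperty X) where
  comp_mem S S' φ hφ _ f hf := by
    rcases hf with hf | ⟨c, hc⟩
    · exact Or.inl (range_subset_iff.2 fun z => hf (mem_range_self (φ z)))
    · exact Or.inr ⟨c, fun z => hc (φ z)⟩
  mem_of_restrict S f hf := by
    -- If `f p ∈ X`, then `f` is constant on a coordinate disc at `p`, hence on the whole of `S`.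
    by_contra hmem
    obtain ⟨hX, hconst⟩ := not_or.1 hmem
    obtain ⟨_, ⟨p, rfl⟩, hp⟩ := not_subset.1 hX
    refine hconst ⟨f p, f.2.eq_of_eventually_eq ?_⟩
    obtain ⟨r, hr, hball⟩ := exists_closedBall_chartAt (p := p) univ_mem
    replace hball := hball.trans inter_subset_left
    set e := chartAt ℂ p
    have hps : p ∈ e.source := mem_chart_source ℂ p
    set B := Metric.ball (e p) r
    have hB : B ⊆ e.target := fun z hz => hball (Metric.ball_subset_closedBall hz)
    set Ω : TopologicalSpace.Opens S :=
      ⟨e.symm '' B, e.isOpen_image_symm_of_subset_target Metric.isOpen_ball hB⟩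
    have hpΩ : p ∈ Ω := ⟨e p, Metric.mem_ball_self hr, e.left_inv hps⟩
    have hΩ : IsConnected (Ω : Set S) :=
      ((convex_ball _ _).isConnected (Metric.nonempty_ball.2 hr)).image _
        (e.continuousOn_symm.mono hB)
    have hcpt : IsCompact (closure (Ω : Set S)) :=
      (isCompact_chartAt_symm_image (isCompact_closedBall (e p) r) hball).closure_of_subset
        (image_mono Metric.ball_subset_closedBall)
    rcases hf Ω hΩ hcpt with h | ⟨c, hc⟩
    · exact absurd (h (mem_range_self (⟨p, hpΩ⟩ : Ω))) hp
    · filter_upwards [Ω.isOpen.mem_nhds hpΩ] with x hx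
      exact (hc (⟨x, hx⟩ : Ω)).trans (hc (⟨p, hpΩ⟩ : Ω)).symm
  isClosed S := by
    -- The complement is open by Hurwitz's theorem.
    rw [← isOpen_compl_iff, isOpen_iff_mem_nhds]
    intro f hmem
    obtain ⟨hX, hconst⟩ := not_or.1 hmem
    obtain ⟨_, ⟨p, rfl⟩, hp⟩ := not_subset.1 hX
    have htend : Tendsto HolMap.toContinuousMap (𝓝 f) (𝓝 f.toContinuousMap) :=
      continuous_induced_dom.tendsto f
    obtain ⟨q, hq⟩ : ∃ q, f q ≠ f p := by
      by_contra! h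
      exact hconst ⟨f p, h⟩
    have hmem' : ∀ᶠ g : HolMap S in 𝓝 f, f p ∈ range g :=
      eventually_mem_range_of_tendsto htend (fun g => g.2) f.2
        fun hev => hq (f.2.eq_of_eventually_eq hev q)
    have hev : ∀ x : S, Tendsto (fun g : HolMap S => g x) (𝓝 f) (𝓝 (f x)) := fun x =>
      ((continuous_eval_const x).tendsto f.toContinuousMap).comp htend
    have hne : ∀ᶠ g : HolMap S in 𝓝 f, g q ≠ g p := 
      ((hev q).prodMk_nhds (hev p)).eventually (isClosed_diagonal.isOpen_compl.mem_nhds hq)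
    filter_upwards [hmem', hne] with g hg hgne
    rintro (h | ⟨c, hc⟩)
    · exact h hg (not_not.1 hp)
    · exact hgne ((hc q).trans (hc p).symm)

theorem isNormalFamily_omitProperty {X : Set CHat} (hX : 3 ≤ X.encard) (S : RiemannSurface.{u}) :
    IsNormalFamily (omitProperty.{u} X S) := by
  intro F hF
  obtain ⟨t, htX, ht⟩ := exists_subset_encard_eq hX
  obtain ⟨a, b, c, hab, hac, hbc, rfl⟩ := encard_eq_three.1 ht
  have heq : Equicontinuous fun n => ((F n).toContinuousMap : S → CHat) := fun p =>
    (equicontinuousAt_of_mem_omitProperty (htX (by simp)) (htX (by simp)) (htX (by simp))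
      hab hac hbc p).comp fun n => (⟨F n, hF n⟩ : omitProperty.{u} X S)
  obtain ⟨g, k, hk, hg⟩ := exists_tendsto_subseq_of_equicontinuous _ heq
  have hind : IsInducing (HolMap.toContinuousMap (S := S)) := ⟨rfl⟩
  exact ⟨k, hk, ⟨g, mdifferentiable_of_tendsto hg fun n => (F (k n)).2⟩,
    hind.tendsto_nhds_iff.2 hg⟩

/-- **Picard's little theorem**: on discs of arbitrarily large radius, Landau's theorem makes
the spherical derivative arbitrarily small at the centre. -/
theorem exists_eq_const_of_omits_three {f : ℂ → CHat} (hf : MDifferentiable 𝓘(ℂ) 𝓘(ℂ) f)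
    (hX : 3 ≤ ((range f)ᶜ).encard) : ∃ c, ∀ z, f z = c := by
  obtain ⟨t, htX, ht⟩ := exists_subset_encard_eq hX
  obtain ⟨a, b, c, hab, hac, hbc, rfl⟩ := encard_eq_three.1 ht
  obtain ⟨T, hT, hTa, hTb, hTc⟩ := CHat.exists_homeomorph_mdifferentiable hab hac hbc
  have homit : ∀ y ∈ ({a, b, c} : Set CHat), ∀ z, T (f z) ≠ T y := fun y hy z h =>
    htX hy ⟨z, T.injective h⟩
  have hinf : ∀ z, T (f z) ≠ OnePoint.infty := fun z => hTa ▸ homit a (by simp) z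
  set v : ℂ → ℂ := fun z => CHat.chartZ (T (f z)) with hv
  have hcoe : ∀ z, (v z : CHat) = T (f z) := fun z => CHat.coe_chartZ (hinf z)
  have hd : Differentiable ℂ v := fun z => by
    rw [← mdifferentiableAt_iff_differentiableAt]
    exact (CHat.mdifferentiableAt_chartZ (hinf z)).comp z ((hT.comp hf) z)
  have hder : ∀ z, deriv v z = 0 := by
    intro z
    have hle : ∀ R > 0, ‖deriv v z‖ ≤ 4224 / R * (1 + ‖v z‖ ^ 2) := fun R hR =>
      norm_deriv_le_of_omits_zero_one hR hd.differentiableOn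
        (fun w _ h => homit b (by simp) w (by rw [← hcoe w, h, hTb]))
        (fun w _ h => homit c (by simp) w (by rw [← hcoe w, h, hTc]))
    have hlim : Tendsto (fun R : ℝ => 4224 / R * (1 + ‖v z‖ ^ 2)) atTop (𝓝 0) := by
      simpa using ((tendsto_const_nhds (x := (4224 : ℝ))).div_atTop tendsto_id).mul_const (1 + ‖v z‖ ^ 2)
    exact norm_le_zero_iff.1 (ge_of_tendsto hlim ((eventually_gt_atTop 0).mono hle))
  refine ⟨f 0, fun z => T.injective ?_⟩
  rw [← hcoe z, ← hcoe 0, is_const_of_deriv_eq_zero hd hder z 0]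

theorem theorem2p9 :
    (∀ X : Set CHat,
      IsClosedProperty.{u} (omitProperty X) ∧
      (3 ≤ X.encard → IsCompactProperty.{u} (omitProperty X))) ∧
    (∀ f : ℂ → CHat, MDifferentiable 𝓘(ℂ) 𝓘(ℂ) f → 3 ≤ ((range f)ᶜ).encard →
      ∃ c, ∀ z, f z = c) :=
  ⟨fun X => ⟨isClosedProperty_omitProperty X, fun hX =>
    { toIsClosedProperty := isClosedProperty_omitProperty X
      isNormalFamily := isNormalFamily_omitProperty hX }⟩,
    fun _ hf hX => exists_eq_const_of_omits_three hf hX⟩
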